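/- A leak in a finite simple graph $G$ is a vertex that is not allowed to perform a force. Given a set of leaks and a set of blue vertices (all other vertices being white), a blue vertex $u$ that is not a leak may force a white vertex $v$ to become blue if $v$ is the only white neighbor of $u$. For an integer $\ell\ge 0$, a set $B\subseteq V(G)$ is an $\ell$-leaky forcing set if, for every set $L$ of $\ell$ vertices of $G$ chosen as leaks, starting with exactly the vertices of $B$ blue and applying this rule repeatedly can turn all of $V(G)$ blue. Let $\mathrm{Z}_{(\ell)}(G)$ denote the minimum size of an $\ell$-leaky forcing set of $G$. Let $P_k$ be the path on $k$ vertices and $\square$ the Cartesian product of graphs. **Theorem.** Let $n$ and $m$ be integers with $n\ge 1$ and $m\ge 2n^2$. Then $\mathrm{Z}_{(1)}(P_n\,\square\,P_m)=2n$. -/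

import Mathlib

/-- The zero forcing color change rule in the presence of leaks: if `S` is the set of blue vertices
(all others are white) and `L` the set of leaks, the force `u → v` is valid when `u` is blue and not
a leak, and `v` is the only white neighbor of `u`. -/
def LeakyValidForce {V : Type*} (G : SimpleGraph V) (L S : Set V) (u v : V) : Prop :=
  u ∈ S ∧ u ∉ L ∧ G.Adj u v ∧ v ∉ S ∧ ∀ w, G.Adj u w → w ∉ S → w = v

/-- One application of the color change rule: the blue set `S` becomes `T` by one valid force. -/
def LeakyForceStep {V : Type*} (G : SimpleGraph V) (L S T : Set V) : Prop :=
  ∃ u v, LeakyValidForce G L S u v ∧ T = insert v S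

/-- With leaks `L`, the initial blue set `B` can color every vertex of `G` blue by a finite
sequence of valid forces. -/
def ForcesDespite {V : Type*} (G : SimpleGraph V) (L B : Set V) : Prop :=
  Relation.ReflTransGen (LeakyForceStep G L) B Set.univ

/-- `B` is an `ℓ`-leaky forcing set of `G`: whichever `ℓ` vertices are chosen to be leaks,
`B` forces all of `G`. -/
def IsLeakyForcingSet {V : Type*} (G : SimpleGraph V) (ℓ : ℕ) (B : Finset V) : Prop :=
  ∀ L : Finset V, L.card = ℓ → ForcesDespite G (L : Set V) (B : Set V)

/-- The `ℓ`-leaky forcing number: the size of a minimum `ℓ`-leaky forcing set. -/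
noncomputable def leakyForcingNumber {V : Type*} [Fintype V] (G : SimpleGraph V) (ℓ : ℕ) : ℕ :=
  sInf {k : ℕ | ∃ B : Finset V, IsLeakyForcingSet G ℓ B ∧ B.card = k}

/-- The minimum in the definition of the leaky forcing number is attained. -/
theorem leakyForcingNumber_isLeast {V : Type*} [Fintype V] (G : SimpleGraph V) (ℓ : ℕ) :
    IsLeast {k : ℕ | ∃ B : Finset V, IsLeakyForcingSet G ℓ B ∧ B.card = k}
      (leakyForcingNumber G ℓ) := by
  refine ⟨Nat.sInf_mem ⟨_, Finset.univ, ?_, rfl⟩, fun k hk => Nat.sInf_le hk⟩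
  intro L _
  rw [Finset.coe_univ]
  exact Relation.ReflTransGen.refl

/-- The rectangular grid graph `P_n □ P_m`, with `n` rows and `m` columns. -/
def gridGraph (n m : ℕ) : SimpleGraph (Fin n × Fin m) :=
  SimpleGraph.boxProd (SimpleGraph.pathGraph n) (SimpleGraph.pathGraph m)

/-! Upper bound: the two end columns sweep inward from both sides and meet at the leak's column.
Lower bound: fewer than `2n` blue vertices miss one of `2n` blocks of `n` columns and, up to
reflection, fewer than `n` of them lie left of it. Run leak-free forcing from those. Some row `w`
stays white (`exists_white_row`), so the forced set enters the block only in a wedge away from `w`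
(`mem_wedge_of_white_row`). The white vertices left of a cone ending in the block form a fort whose
only defect is the cone's tip, and the leak goes there. -/

theorem gridGraph_adj {n m : ℕ} (x y : Fin n × Fin m) :
    (gridGraph n m).Adj x y ↔
      ((x.1.val + 1 = y.1.val ∨ y.1.val + 1 = x.1.val) ∧ x.2.val = y.2.val) ∨
      ((x.2.val + 1 = y.2.val ∨ y.2.val + 1 = x.2.val) ∧ x.1.val = y.1.val) := by
  simp [gridGraph, SimpleGraph.boxProd_adj, SimpleGraph.pathGraph_adj, Fin.ext_iff]

/-! ### Stalled sets and forts -/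

/-- The color change process can be run until no force is possible. -/
theorem exists_stalled {V : Type*} [Finite V] (G : SimpleGraph V) (L B : Set V) :
    ∃ S, Relation.ReflTransGen (LeakyForceStep G L) B S ∧
      ∀ u v, ¬ LeakyValidForce G L S u v := by
  obtain ⟨S, hS⟩ := (Set.toFinite {S | Relation.ReflTransGen (LeakyForceStep G L) B S}).exists_maximal
    ⟨B, Relation.ReflTransGen.refl⟩
  refine ⟨S, hS.prop, fun u v h => ?_⟩
  have hmem : insert v S ∈ {S | Relation.ReflTransGen (LeakyForceStep G L) B S} :=
    Relation.ReflTransGen.tail hS.prop ⟨u, v, h, rfl⟩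
  exact h.2.2.2.1 (hS.le_of_ge hmem (Set.subset_insert v S) (Set.mem_insert v S))

theorem subset_of_reflTransGen {V : Type*} {G : SimpleGraph V} {L B S : Set V}
    (h : Relation.ReflTransGen (LeakyForceStep G L) B S) : B ⊆ S := by
  induction h with
  | refl => exact subset_rfl
  | tail _ hs ih =>
    obtain ⟨u, v, -, rfl⟩ := hs
    exact ih.trans (Set.subset_insert _ _)

/-- A leaky fort: a nonempty set such that no vertex outside it, other than the leaks, has exactly
one neighbor in it. -/
def IsLeakyFort {V : Type*} (G : SimpleGraph V) (L F : Set V) : Prop :=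
  F.Nonempty ∧ ∀ u, u ∉ F → u ∉ L → ∀ v ∈ F, G.Adj u v → ∃ w ∈ F, G.Adj u w ∧ w ≠ v

/-- The first force into `F` would come from a non-leak outside `F`, which has a second neighbor in
the still white `F`. -/
theorem IsLeakyFort.not_forcesDespite {V : Type*} {G : SimpleGraph V} {L F B : Set V}
    (hF : IsLeakyFort G L F) (hB : Disjoint B F) : ¬ ForcesDespite G L B := by
  intro h
  have key : ∀ S, Relation.ReflTransGen (LeakyForceStep G L) B S → Disjoint S F := by
    intro S hS
    induction hS with
    | refl => exact hB
    | tail _ hs ih =>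
      obtain ⟨u, v, ⟨hu, huL, huv, -, huniq⟩, rfl⟩ := hs
      rw [Set.disjoint_insert_left]
      refine ⟨fun hvF => ?_, ih⟩
      obtain ⟨w, hwF, huw, hwv⟩ := hF.2 u (Set.disjoint_left.1 ih hu) huL v hvF huv
      exact hwv (huniq w huw (Set.disjoint_right.1 ih hwF))
  obtain ⟨x, hx⟩ := hF.1
  exact Set.disjoint_left.1 (key _ h) (Set.mem_univ x) hx

theorem IsLeakyFort.preimage {V : Type*} {G : SimpleGraph V} {L F : Set V}
    (hF : IsLeakyFort G L F) (e : G ≃g G) : IsLeakyFort G (e ⁻¹' L) (e ⁻¹' F) := by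
  refine ⟨hF.1.preimage e.surjective, fun u hu huL v hv huv => ?_⟩
  obtain ⟨w, hw, huw, hwv⟩ := hF.2 (e u) hu huL (e v) hv (e.map_adj_iff.2 huv)
  refine ⟨e.symm w, by simpa using hw, ?_, ?_⟩
  · rw [← e.map_adj_iff]
    simpa using huw
  · rintro rfl
    simp at hwv

/-! ### Upper bound -/

/-- Both end columns of the grid together form a `1`-leaky forcing set. -/
theorem isLeakyForcingSet_endColumns (n m : ℕ) (B : Finset (Fin n × Fin m))
    (hB : ∀ x : Fin n × Fin m, x.2.val = 0 ∨ x.2.val + 1 = m → x ∈ B) :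
    IsLeakyForcingSet (gridGraph n m) 1 B := by
  intro L hL
  obtain ⟨z, rfl⟩ := Finset.card_eq_one.1 hL
  obtain ⟨S, hS, hstall⟩ := exists_stalled (gridGraph n m) (({z} : Finset _) : Set _) (B : Set _)
  have hBS := subset_of_reflTransGen hS
  -- Forces into column `c + 1` start in column `c`, strictly before the leak's column, so no leak
  -- interferes.
  have left : ∀ c, c ≤ z.2.val → ∀ x : Fin n × Fin m, x.2.val ≤ c → x ∈ S := by
    intro c
    induction c with
    | zero => exact fun _ x hx => hBS (hB x (Or.inl (by omega)))
    | succ c ih =>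
      intro hc x hx
      have ih := ih (by omega)
      by_contra hxS
      have hxc : ¬ x.2.val ≤ c := fun h => hxS (ih x h)
      have hcm : c < m := by have := x.2.isLt; omega
      refine hstall (x.1, ⟨c, hcm⟩) x ⟨ih _ le_rfl, ?_, ?_, hxS, ?_⟩
      · simp only [Finset.coe_singleton, Set.mem_singleton_iff]
        rintro rfl
        simp at hc
      · rw [gridGraph_adj]; simp only [and_true]; omega
      · intro w hw hwS
        rw [gridGraph_adj] at hw
        simp only at hw
        have hwc : ¬ w.2.val ≤ c := fun h => hwS (ih w h)
        ext <;> omega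
  have right : ∀ c, z.2.val + c < m → ∀ x : Fin n × Fin m, m ≤ x.2.val + c + 1 → x ∈ S := by
    intro c
    induction c with
    | zero => exact fun _ x hx => hBS (hB x (Or.inr (by have := x.2.isLt; omega)))
    | succ c ih =>
      intro hc x hx
      have ih := ih (by omega)
      by_contra hxS
      have hxc : ¬ m ≤ x.2.val + c + 1 := fun h => hxS (ih x h)
      refine hstall (x.1, ⟨x.2.val + 1, by omega⟩) x
        ⟨ih _ (by simp only; omega), ?_, ?_, hxS, ?_⟩
      · simp only [Finset.coe_singleton, Set.mem_singleton_iff]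
        intro h
        rw [← h] at hc
        simp only at hc
        omega
      · rw [gridGraph_adj]; simp
      · intro w hw hwS
        rw [gridGraph_adj] at hw
        simp only at hw
        have hwc : ¬ m ≤ w.2.val + c + 1 := fun h => hwS (ih w h)
        ext <;> omega
  have hU : S = Set.univ := by
    rw [Set.eq_univ_iff_forall]
    intro x
    have := z.2.isLt
    rcases le_total x.2.val z.2.val with h | h
    · exact left _ le_rfl x h
    · exact right (m - 1 - z.2.val) (by omega) x (by omega)
  rwa [hU] at hS

theorem leakyForcingNumber_gridGraph_le (n m : ℕ) (hm : 0 < m) :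
    leakyForcingNumber (gridGraph n m) 1 ≤ 2 * n := by
  classical
  let B : Finset (Fin n × Fin m) := Finset.univ ×ˢ {⟨0, hm⟩, ⟨m - 1, by omega⟩}
  refine ((leakyForcingNumber_isLeast _ 1).2
    ⟨B, isLeakyForcingSet_endColumns n m B ?_, rfl⟩).trans ?_
  · intro x hx
    simp only [B, Finset.mem_product, Finset.mem_univ, true_and, Finset.mem_insert,
      Finset.mem_singleton, Fin.ext_iff]
    omega
  · rw [Finset.card_product, Finset.card_univ, Fintype.card_fin, mul_comm 2]
    exact Nat.mul_le_mul_left _ Finset.card_le_two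

/-! ### White rows and wedges -/

theorem exists_pathGraph_adj_of_ne {k : ℕ} (P : Fin k → Prop) {x y : Fin k} (hx : P x)
    (hy : ¬ P y) : ∃ u v, (SimpleGraph.pathGraph k).Adj u v ∧ P u ∧ ¬ P v := by
  by_contra! h
  have hr := (SimpleGraph.reachable_iff_reflTransGen x y).1 (SimpleGraph.pathGraph_preconnected k x y)
  apply hy
  induction hr with
  | refl => exact hx
  | tail _ hs ih => exact h _ _ hs (by by_contra h'; exact h' (ih h'))

theorem exists_not_mem_image {α : Type*} {k : ℕ} (T : Finset α) (f : α → Fin k)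
    (hT : T.card < k) : ∃ r, ∀ x ∈ T, f x ≠ r := by
  classical
  by_contra! h
  have : (Finset.univ : Finset (Fin k)) ⊆ T.image f := fun r _ => by
    obtain ⟨x, hx, rfl⟩ := h r
    exact Finset.mem_image_of_mem f hx
  have := (Finset.card_le_card this).trans Finset.card_image_le
  simp at this
  omega

/-- Fewer than `n` blue vertices always leave a whole row of the grid white; moreover the blue
vertices with a white neighbor never outnumber the initial ones. -/
theorem exists_white_row {n m : ℕ} (A : Finset (Fin n × Fin m)) (hA : A.card < n) (hm : n < m)
    {S : Set (Fin n × Fin m)}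
    (hS : Relation.ReflTransGen (LeakyForceStep (gridGraph n m) ∅) A S) :
    (∃ T : Finset (Fin n × Fin m), T.card ≤ A.card ∧
      ∀ x ∈ S, ∀ y, y ∉ S → (gridGraph n m).Adj x y → x ∈ T) ∧
    ∃ r : Fin n, ∀ c, (r, c) ∉ S := by
  classical
  induction hS with
  | refl =>
    refine ⟨⟨A, le_rfl, fun x hx _ _ _ => hx⟩, ?_⟩
    obtain ⟨r, hr⟩ := exists_not_mem_image A Prod.fst hA
    exact ⟨r, fun c hc => hr _ hc rfl⟩
  | @tail S S' _ hs ih =>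
    obtain ⟨u, v, ⟨huS, -, huv, hvS, huniq⟩, rfl⟩ := hs
    obtain ⟨⟨T, hTA, hT⟩, r₀, hr₀⟩ := ih
    have huT : u ∈ T := hT u huS v hvS huv
    -- After forcing, `u` has no white neighbor left, so `v` can take its place.
    let T' := insert v (T.erase u)
    have hT'A : T'.card ≤ A.card := by
      have h₁ := Finset.card_insert_le v (T.erase u)
      have h₂ := Finset.card_erase_add_one huT
      simp only [T']; omega
    have hT' : ∀ x ∈ insert v S, ∀ y, y ∉ insert v S → (gridGraph n m).Adj x y → x ∈ T' := by
      intro x hx y hy hxy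
      simp only [Set.mem_insert_iff, not_or] at hx hy
      simp only [T', Finset.mem_insert, Finset.mem_erase]
      rcases hx with hx | hx
      · exact Or.inl hx
      · refine Or.inr ⟨?_, hT x hx y hy.2 hxy⟩
        rintro rfl
        exact hy.1 (huniq y hxy hy.2)
    refine ⟨⟨T', hT'A, hT'⟩, ?_⟩
    obtain ⟨r, hr⟩ := exists_not_mem_image T' Prod.fst (by omega)
    refine ⟨r, fun c hc => ?_⟩
    -- A row that misses `T'` is monochromatic; were it blue, a column avoiding `T` and `v` would
    -- run from blue to the white row `r₀` without a vertex of `T`.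
    have hrow : ∀ d, (r, d) ∈ insert v S := by
      intro d
      by_contra hd
      obtain ⟨p, q, hpq, hp, hq⟩ :=
        exists_pathGraph_adj_of_ne (fun d => (r, d) ∈ insert v S) hc hd
      exact hr _ (hT' _ hp _ hq (SimpleGraph.boxProd_adj.2 (Or.inr ⟨hpq, rfl⟩))) rfl
    obtain ⟨d, hd⟩ := exists_not_mem_image (insert v T) Prod.snd
      (by have := Finset.card_insert_le v T; omega)
    have hdS : (r, d) ∈ S := (hrow d).resolve_left
      fun h => hd v (Finset.mem_insert_self _ _) (by rw [← h])
    obtain ⟨p, q, hpq, hp, hq⟩ := exists_pathGraph_adj_of_ne (fun t => (t, d) ∈ S) hdS (hr₀ d)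
    exact hd _ (Finset.mem_insert_of_mem
      (hT _ hp _ hq (SimpleGraph.boxProd_adj.2 (Or.inl ⟨hpq, rfl⟩)))) rfl

/-- If row `w` stays white, then the vertices forced from the columns before `a` lie in a wedge
pointing away from row `w`. -/
theorem mem_wedge_of_white_row {n m a : ℕ} (ham : a + n ≤ m) {A S : Set (Fin n × Fin m)}
    (hA : ∀ x ∈ A, x.2.val < a)
    (hS : Relation.ReflTransGen (LeakyForceStep (gridGraph n m) ∅) A S)
    (w : Fin n) (hw : ∀ c, (w, c) ∉ S) :
    ∀ x ∈ S, x.2.val < a ∨ x.2.val + 2 + w.val ≤ a + x.1.val ∨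
      x.2.val + 2 + x.1.val ≤ a + w.val := by
  induction hS with
  | refl => exact fun x hx => Or.inl (hA x hx)
  | @tail S S' _ hs ih =>
    obtain ⟨⟨p, q⟩, ⟨t, c⟩, ⟨huS, -, huv, hvS, huniq⟩, rfl⟩ := hs
    have ih := ih fun d hd => hw d (Set.mem_insert_of_mem _ hd)
    have hne : ∀ x ∈ insert (t, c) S, x.1.val ≠ w.val := by
      rintro ⟨x, y⟩ hx h
      obtain rfl : x = w := Fin.ext h
      exact hw y hx
    intro x hx
    rcases hx with rfl | hx
    swap
    · exact ih x hx
    have htw := hne (t, c) (Set.mem_insert _ _)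
    have hpw := hne (p, q) (Set.mem_insert_of_mem _ huS)
    have hu := ih _ huS
    have nb : ∀ (t' c' : ℕ) (ht : t' < n) (hc : c' < m),
        (gridGraph n m).Adj (p, q) (⟨t', ht⟩, ⟨c', hc⟩) → (t' ≠ t.val ∨ c' ≠ c.val) →
        t' ≠ w.val ∧ (c' < a ∨ c' + 2 + w.val ≤ a + t' ∨ c' + 2 + t' ≤ a + w.val) := by
      intro t' c' ht hc hadj hdiff
      have hmem : ((⟨t', ht⟩, ⟨c', hc⟩) : Fin n × Fin m) ∈ S := by
        by_contra hmem
        have := huniq _ hadj hmem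
        simp only [Prod.mk.injEq, Fin.ext_iff] at this
        omega
      exact ⟨hne _ (Set.mem_insert_of_mem _ hmem), ih _ hmem⟩
    have ht := t.isLt
    have hp := p.isLt
    have hq := q.isLt
    have hwn := w.isLt
    simp only [gridGraph_adj] at huv nb
    simp only at hu htw hpw ⊢
    -- Only moves toward row `w` or to the right can leave the wedge. The first needs the right
    -- neighbor already blue, the second the neighbor nearer to `w`; either gives the missing unit.
    rcases huv with ⟨h | h, h'⟩ | ⟨h | h, h'⟩
    · by_cases htw' : t.val < w.val
      · by_cases hca : q.val < a
        · omega
        have := nb p (q + 1) hp (by omega) (by omega) (by omega)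
        omega
      · omega
    · by_cases htw' : w.val < t.val
      · by_cases hca : q.val < a
        · omega
        have := nb p (q + 1) hp (by omega) (by omega) (by omega)
        omega
      · omega
    · by_cases htw' : t.val < w.val
      · have := nb (p + 1) q (by omega) hq (by omega) (by omega)
        omega
      · have := nb (p - 1) q (by omega) hq (by omega) (by omega)
        omega
    · omega

/-! ### The fort and the lower bound -/

/-- An empty block of `n` columns with fewer than `n` blue vertices on its left
admits a leaky fort that avoids all blue vertices. -/
theorem exists_leakyFort_of_left {n m a : ℕ} (ham : a + n ≤ m) (hnm : n < m)
    (B : Finset (Fin n × Fin m)) (hgap : ∀ x ∈ B, x.2.val < a ∨ a + n ≤ x.2.val)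
    (hleft : (B.filter fun x => x.2.val < a).card < n) :
    ∃ z F, IsLeakyFort (gridGraph n m) {z} F ∧ Disjoint (B : Set (Fin n × Fin m)) F := by
  obtain ⟨S, hS, hstall⟩ := exists_stalled (gridGraph n m) ∅
    ((B.filter fun x => x.2.val < a : Finset _) : Set (Fin n × Fin m))
  have hBS := subset_of_reflTransGen hS
  obtain ⟨-, w, hw⟩ := exists_white_row _ hleft hnm hS
  have wedge := mem_wedge_of_white_row ham (fun x hx => (Finset.mem_filter.1 hx).2) hS w hw
  have hne : ∀ x ∈ S, x.1.val ≠ w.val := by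
    rintro ⟨x, y⟩ hx h
    obtain rfl : x = w := Fin.ext h
    exact hw y hx
  have hwn := w.isLt
  -- Mirroring `w` gives `|t - w| + |t - i| ≤ n - 1` for every row `t`, which keeps the cone's
  -- boundary clear of the wedge.
  obtain ⟨i, hi⟩ : ∃ i : ℕ, i + w.val + 1 = n := ⟨n - 1 - w, by omega⟩
  let F : Set (Fin n × Fin m) :=
    {x | x ∉ S ∧ x.2.val + x.1.val < a + n + i ∧ x.2.val + i < a + n + x.1.val}
  -- The leak is the tip `(i, a + n)`; if `a + n = m` the tip is off the grid and any leak would do.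
  refine ⟨(⟨i, by omega⟩, ⟨min (a + n) (m - 1), by omega⟩), F, ⟨⟨(w, ⟨a, by omega⟩), hw _, ?_, ?_⟩, ?_⟩, ?_⟩
  · simp only; omega
  · simp only; omega
  · rintro ⟨t, c⟩ hu huz ⟨t', c'⟩ ⟨hvS, hv₁, hv₂⟩ huv
    have ht := t.isLt
    have hc := c.isLt
    simp only [Set.mem_singleton_iff, Prod.mk.injEq, Fin.ext_iff] at huz
    simp only at hv₁ hv₂
    by_cases huS : (t, c) ∈ S
    · have hforce := hstall (t, c) (t', c')
      have : ∃ x, (gridGraph n m).Adj (t, c) x ∧ x ∉ S ∧ x ≠ (t', c') := by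
        by_contra! h
        exact hforce ⟨huS, by simp, huv, hvS, h⟩
      obtain ⟨⟨x, y⟩, hx, hxS, hxne⟩ := this
      refine ⟨(x, y), ⟨hxS, ?_⟩, hx, hxne⟩
      have h₁ := wedge _ huS
      have h₂ := hne _ huS
      have hxn := x.isLt
      rw [gridGraph_adj] at hx
      simp only at h₁ h₂ hx ⊢
      omega
    · have huF : ¬ (c.val + t.val < a + n + i ∧ c.val + i < a + n + t.val) :=
        fun h => hu ⟨huS, h⟩
      have white : ∀ (x y : ℕ) (hx : x < n) (hy : y < m), a + x ≤ y + 1 + w.val →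
          a + w.val ≤ y + 1 + x → y + x < a + n + i → y + i < a + n + x →
          ((⟨x, hx⟩, ⟨y, hy⟩) : Fin n × Fin m) ∈ F := by
        intro x y hx hy h₁ h₂ h₃ h₄
        refine ⟨fun h => ?_, h₃, h₄⟩
        have h₅ := wedge _ h
        have h₆ := hne _ h
        simp only at h₅ h₆
        omega
      have other : ∀ (x y : ℕ) (hx : x < n) (hy : y < m), a + x ≤ y + 1 + w.val →
          a + w.val ≤ y + 1 + x → y + x < a + n + i → y + i < a + n + x →
          (((t.val + 1 = x ∨ x + 1 = t.val) ∧ c.val = y) ∨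
            ((c.val + 1 = y ∨ y + 1 = c.val) ∧ t.val = x)) → (x ≠ t'.val ∨ y ≠ c'.val) →
          ∃ w ∈ F, (gridGraph n m).Adj (t, c) w ∧ w ≠ (t', c') := by
        intro x y hx hy h₁ h₂ h₃ h₄ h₅ h₆
        refine ⟨_, white x y hx hy h₁ h₂ h₃ h₄, (gridGraph_adj _ _).2 h₅, ?_⟩
        simp only [ne_eq, Prod.mk.injEq, Fin.ext_iff]
        omega
      rw [gridGraph_adj] at huv
      simp only at huv
      -- Off row `i`, a vertex just outside the cone has two neighbors in `F`: to its left, and in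
      -- its column toward row `i`.
      rcases lt_trichotomy t.val i with hti | hti | hti
      · rcases huv with huv | huv
        · exact other t (c - 1) ht (by omega) (by omega) (by omega) (by omega) (by omega)
            (by omega) (by omega)
        · exact other (t + 1) c (by omega) hc (by omega) (by omega) (by omega) (by omega)
            (by omega) (by omega)
      · omega
      · rcases huv with huv | huv
        · exact other t (c - 1) ht (by omega) (by omega) (by omega) (by omega) (by omega)
            (by omega) (by omega)
        · exact other (t - 1) c (by omega) hc (by omega) (by omega) (by omega) (by omega)
            (by omega) (by omega)
  · rw [Set.disjoint_left]
    rintro x hx ⟨hxS, h₁, h₂⟩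
    rcases hgap x hx with h | h
    · exact hxS (hBS (by simpa using ⟨hx, h⟩))
    · omega

/-- The reflection of the grid that reverses the order of the columns. -/
def gridReflection (n m : ℕ) : gridGraph n m ≃g gridGraph n m where
  toEquiv := (Equiv.refl _).prodCongr Fin.revPerm
  map_rel_iff' := by
    rintro ⟨x, y⟩ ⟨x', y'⟩
    simp only [gridGraph_adj, Equiv.prodCongr_apply, Prod.map_apply, Equiv.refl_apply,
      Fin.revPerm_apply, Fin.val_rev]
    omega

theorem gridReflection_apply {n m : ℕ} (x : Fin n × Fin m) :
    gridReflection n m x = (x.1, x.2.rev) := rfl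

theorem exists_leakyFort_of_card_lt {n m : ℕ} (hm : 2 * n ^ 2 ≤ m) (B : Finset (Fin n × Fin m))
    (hB : B.card < 2 * n) :
    ∃ z F, IsLeakyFort (gridGraph n m) {z} F ∧ Disjoint (B : Set (Fin n × Fin m)) F := by
  classical
  have hn : 0 < n := by omega
  have hnm : n < m := by nlinarith
  obtain ⟨k, hk, hkB⟩ : ∃ k < 2 * n, ∀ x ∈ B, x.2.val / n ≠ k := by
    by_contra! h
    have : Finset.range (2 * n) ⊆ B.image fun x => x.2.val / n := fun k hk => by
      obtain ⟨x, hx, rfl⟩ := h k (Finset.mem_range.1 hk)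
      exact Finset.mem_image_of_mem (fun x : Fin n × Fin m => x.2.val / n) hx
    have := (Finset.card_le_card this).trans Finset.card_image_le
    rw [Finset.card_range] at this
    omega
  obtain ⟨a, ha⟩ : ∃ a, a = k * n := ⟨_, rfl⟩
  have ham : a + n ≤ m := by nlinarith
  have hgap : ∀ x ∈ B, x.2.val < a ∨ a + n ≤ x.2.val := by
    intro x hx
    by_contra! h
    refine hkB x hx (Nat.div_eq_of_lt_le (ha ▸ h.1) ?_)
    rw [Nat.succ_mul]
    omega
  by_cases hleft : (B.filter fun x => x.2.val < a).card < n
  · exact exists_leakyFort_of_left ham hnm B hgap hleft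
  -- The left side has at least `n` blue vertices, so the right has fewer than `n`: reflect.
  let e := gridReflection n m
  let B' := B.map e.toEquiv.toEmbedding
  have hright : (B.filter fun x => ¬ x.2.val < a).card < n := by
    have := Finset.card_filter_add_card_filter_not (s := B) (fun x => x.2.val < a)
    omega
  obtain ⟨z, F, hF, hdisj⟩ := exists_leakyFort_of_left (a := m - a - n) (by omega) hnm B'
    (by
      intro x hx
      obtain ⟨y, hy, rfl⟩ := Finset.mem_map.1 hx
      have := hgap y hy
      have hym := y.2.isLt
      change (y.2.rev).val < _ ∨ _ ≤ (y.2.rev).val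
      rw [Fin.val_rev]
      omega)
    (by
      refine lt_of_le_of_lt ?_ hright
      rw [Finset.filter_map, Finset.card_map]
      refine Finset.card_le_card fun x hx => ?_
      rw [Finset.mem_filter] at hx ⊢
      refine ⟨hx.1, ?_⟩
      have h : (x.2.rev).val < m - a - n := hx.2
      rw [Fin.val_rev] at h
      omega)
  refine ⟨e.symm z, e ⁻¹' F, ?_, ?_⟩
  · convert hF.preimage e
    ext x
    exact e.toEquiv.eq_symm_apply
  · rw [Set.disjoint_left] at hdisj ⊢
    exact fun x hx hxF => hdisj (Finset.mem_map_of_mem _ hx) hxF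

theorem theorem4p6 (n m : ℕ) (hm : 2 * n ^ 2 ≤ m) :
    leakyForcingNumber (gridGraph n m) 1 = 2 * n := by
  obtain ⟨B, hB, hcard⟩ := (leakyForcingNumber_isLeast (gridGraph n m) 1).1
  rcases Nat.eq_zero_or_pos n with rfl | hn
  · have : B = ∅ := Finset.eq_empty_of_isEmpty B
    rw [← hcard, this, Finset.card_empty]
  refine le_antisymm (leakyForcingNumber_gridGraph_le n m (by nlinarith)) ?_
  by_contra! hlt
  obtain ⟨z, F, hF, hdisj⟩ := exists_leakyFort_of_card_lt hm B (hcard ▸ hlt)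
  exact hF.not_forcesDespite hdisj (by simpa using hB {z} (Finset.card_singleton z))
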